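/- Let $\Gamma=\langle S\mid R\rangle$ be the Higman group, with $S=\{a,b,c,d,a^{-1},b^{-1},c^{-1},d^{-1}\}$ and $R=\{a^{-1}ba=b^2,\ b^{-1}cb=c^2,\ c^{-1}dc=d^2,\ d^{-1}ad=a^2\}$, and let $G$ be its Cayley graph: the simple graph with vertex set $\Gamma$ in which $\gamma_1,\gamma_2$ are adjacent if and only if $\gamma_2=\gamma_1s$ for some $s\in S$. Write $\mathbf 1$ for the identity of $\Gamma$. A *graph height function* on $G$ is a pair $(h,\mathcal H)$ in which $\mathcal H$ is a subgroup of $\mathrm{Aut}(G)$ acting quasi-transitively on $G$ (some finite set of vertices meets every $\mathcal H$-orbit) and $h:\Gamma\to\mathbb Z$ satisfies: (a) $h(\mathbf 1)=0$; (b) $h(v)-h(w)=h(\gamma v)-h(\gamma w)$ for all vertices $v,w$ and all $\gamma\in\mathcal H$; (c) every vertex $v$ has neighbours $u,w$ with $h(u)<h(v)<h(w)$. A *group height function* on $\Gamma$ is a function $h:\Gamma\to\mathbb Z$, not identically zero, with $h(\mathbf 1)=0$, such that $h(s_1\cdots s_m)=\sum_{i=1}^m h(s_i)$ for all $s_1,\dots,s_m\in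 S$, and $\sum_{i=1}^m h(s_i)=0$ whenever $s_1\cdots s_m=\mathbf 1$ with all $s_i\in S$. Then $G$ has no graph height function. Moreover: 1. $\Gamma$ has no group height function; 2. the stabiliser of the vertex $\mathbf 1$ in $\mathrm{Aut}(G)$ is the cyclic group generated by the automorphism of $G$ induced by the group automorphism $a\mapsto b\mapsto c\mapsto d\mapsto a$ of $\Gamma$; 3. $\Gamma$ has no proper normal subgroup of finite index. -/

import Mathlib

/-! ### Height functions on graphs and groups -/

/-- A group `H` of automorphisms of `G` acts quasi-transitively if some finite set of vertices
meets every `H`-orbit. -/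
def ActsQuasiTransitively {V : Type*} (G : SimpleGraph V) (H : Subgroup (G ≃g G)) : Prop :=
  ∃ W : Set V, W.Finite ∧ ∀ v : V, ∃ α ∈ H, ∃ w ∈ W, α v = w

/-- The function `h` on vertices is `H`-difference-invariant. -/
def IsDifferenceInvariant {V : Type*} (G : SimpleGraph V) (H : Subgroup (G ≃g G))
    (h : V → ℤ) : Prop :=
  ∀ v w : V, ∀ γ ∈ H, h v - h w = h (γ v) - h (γ w)

/-- The pair `(h, H)` is a graph height function on the graph `G` with origin `o`. -/
structure IsGraphHeightFunction {V : Type*} (G : SimpleGraph V) (o : V)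
    (h : V → ℤ) (H : Subgroup (G ≃g G)) : Prop where
  quasiTransitive : ActsQuasiTransitively G H
  map_origin : h o = 0
  differenceInvariant : IsDifferenceInvariant G H h
  exists_lt_lt : ∀ v : V, ∃ u w : V, G.Adj v u ∧ G.Adj v w ∧ h u < h v ∧ h v < h w

/-- The function `h` is a group height function on `Γ` with respect to the
generating set `S`. -/
structure IsGroupHeightFunction {Γ : Type*} [Group Γ] (S : Set Γ) (h : Γ → ℤ) : Prop where
  map_one : h 1 = 0
  ne_zero : ∃ γ : Γ, h γ ≠ 0
  map_prod : ∀ l : List Γ, (∀ s ∈ l, s ∈ S) → h l.prod = (l.map h).sum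
  sum_eq_zero : ∀ l : List Γ, (∀ s ∈ l, s ∈ S) → l.prod = 1 → (l.map h).sum = 0

/-! ### The Higman group and its Cayley graph -/

namespace Higman

/-- The four relators `sᵢ⁻¹ sᵢ₊₁ sᵢ = sᵢ₊₁²`, with indices modulo `4`;
the generators `a, b, c, d` are `s₀, s₁, s₂, s₃`. -/
def relators : Set (FreeGroup (Fin 4)) :=
  Set.range fun i : Fin 4 =>
    (FreeGroup.of i)⁻¹ * FreeGroup.of (i + 1) * FreeGroup.of i * (FreeGroup.of (i + 1) ^ 2)⁻¹

/-- The Higman group. -/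
abbrev HigmanGroup : Type := PresentedGroup relators

/-- The generators `a, b, c, d` of the Higman group. -/
def gen (i : Fin 4) : HigmanGroup := PresentedGroup.of i

/-- The symmetric generating set `{a, b, c, d, a⁻¹, b⁻¹, c⁻¹, d⁻¹}`. -/
def generators : Set HigmanGroup :=
  {x | ∃ i : Fin 4, x = gen i ∨ x = (gen i)⁻¹}

/-- The Cayley graph of the Higman group: `γ₁` and `γ₂` are adjacent when `γ₂ = γ₁ s`
with `s` in the symmetric generating set. -/
def cayleyGraph : SimpleGraph HigmanGroup := SimpleGraph.mulCayley generators

theorem gen_rel (i : Fin 4) :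
    (gen i)⁻¹ * gen (i + 1) * gen i * (gen (i + 1) ^ 2)⁻¹ = 1 :=
  PresentedGroup.one_of_mem (rels := relators) ⟨i, rfl⟩

/-- The endomorphism of the Higman group with `sᵢ ↦ sᵢ₊ₖ`. -/
def rotationHom (k : Fin 4) : HigmanGroup →* HigmanGroup :=
  PresentedGroup.toGroup (f := fun i => gen (i + k)) (by
    rintro _ ⟨i, rfl⟩
    have h := gen_rel (i + k)
    rw [add_right_comm] at h
    simpa using h)

theorem rotationHom_gen (k i : Fin 4) : rotationHom k (gen i) = gen (i + k) :=
  PresentedGroup.toGroup.of _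

theorem rotationHom_comp (k l : Fin 4) (h : k + l = 0) :
    (rotationHom l).comp (rotationHom k) = MonoidHom.id HigmanGroup := by
  apply PresentedGroup.ext
  intro i
  change rotationHom l (rotationHom k (gen i)) = gen i
  rw [rotationHom_gen, rotationHom_gen, add_assoc, h, add_zero]

/-- The group automorphism induced by the permutation `(a b c d)` of the generators. -/
def rotationEquiv : HigmanGroup ≃* HigmanGroup :=
  MonoidHom.toMulEquiv (rotationHom 1) (rotationHom 3)
    (rotationHom_comp 1 3 rfl) (rotationHom_comp 3 1 rfl)

theorem rotationHom_mem (k : Fin 4) {x : HigmanGroup} (hx : x ∈ generators) :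
    rotationHom k x ∈ generators := by
  obtain ⟨i, rfl | rfl⟩ := hx
  · exact ⟨i + k, Or.inl (rotationHom_gen k i)⟩
  · exact ⟨i + k, Or.inr (by rw [map_inv, rotationHom_gen])⟩

theorem rotationEquiv_mem_iff (x : HigmanGroup) :
    rotationEquiv x ∈ generators ↔ x ∈ generators := by
  refine ⟨fun h => ?_, fun h => rotationHom_mem 1 h⟩
  have h' := rotationHom_mem 3 h
  have e : rotationHom 3 (rotationEquiv x) = x := rotationEquiv.symm_apply_apply x
  rwa [e] at h'

/-- The automorphism of the Cayley graph induced by the permutation `(a b c d)` of the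
generators. -/
def rotation : cayleyGraph ≃g cayleyGraph where
  toEquiv := rotationEquiv.toEquiv
  map_rel_iff' := by
    intro u v
    change cayleyGraph.Adj (rotationEquiv u) (rotationEquiv v) ↔ cayleyGraph.Adj u v
    simp only [cayleyGraph, SimpleGraph.mulCayley_adj, ← map_inv, ← map_mul,
      rotationEquiv_mem_iff, ne_eq, EmbeddingLike.apply_eq_iff_eq]

end Higman

/-!
A finite vertex stabiliser makes the rest formal: a quasi-transitive group of automorphisms then has
finite index in the automorphism group, hence contains every left translation, because the Higman
group has no proper subgroup of finite index. A graph height function is therefore a homomorphism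
to `ℤ`, and the Higman group is perfect. For the finite quotients, if `nᵢ` is the order of the image
of `sᵢ`, the relators give `2 ^ nᵢ ≡ 1` modulo `nᵢ₊₁`, so a prime factor of `nᵢ₊₁` forces a smaller
prime factor of `nᵢ`, and going around the cycle there can be none.

The stabiliser is computed from the closed walks of length five. Two edges at a vertex lie on a
common one, unless they carry opposite generators `sᵢ^{±1}`, `sᵢ₊₂^{±1}`. Hence an automorphism
preserves opposite pairs, so it maps the line through a vertex in the direction `sᵢ` to such a line.
In a relation `s s x y z = 1` the letter `x` must be the inverse of the generator preceding that of
`s`, so the automorphism also respects the cyclic order and the orientation of the generators, and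
acts near each vertex as a rotation, which is constant along edges.

These facts about short relations rest on two properties of the group. No generator lies in the
subgroup generated by the other three, so no generator occurs exactly once in a relation, and one of
length five involves at most two generators. Opposite generators are free, and adjacent ones map to
`t ↦ t / 2` and `t ↦ t + 1`. Both properties are seen in an amalgam: the subgroups `⟨a, b, c⟩` and
`⟨c, d, a⟩` are represented in the amalgam of two affine groups over the cyclic group of a
translation and a dilation, and two copies of the latter are glued along the free group on `a, c`.
-/

/-! ### Words -/

section Words

variable {ι κ G H : Type*} [Group G] [Group H]

/-- The element `x i` or `(x i)⁻¹` named by an index and a sign; as in `FreeGroup`, the sign `true`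
stands for the positive letter. -/
def letter (x : ι → G) (s : ι × Bool) : G := cond s.2 (x s.1) (x s.1)⁻¹

/-- The letter naming the inverse element. -/
def invLetter (s : ι × Bool) : ι × Bool := (s.1, !s.2)

/-- The value in `G` of a word in the letters `x i` and `(x i)⁻¹`. -/
def wordValue (x : ι → G) (l : List (ι × Bool)) : G := (l.map (letter x)).prod

theorem letter_true (x : ι → G) (i : ι) : letter x (i, true) = x i := rfl

theorem letter_false (x : ι → G) (i : ι) : letter x (i, false) = (x i)⁻¹ := rfl

theorem letter_invLetter (x : ι → G) (s : ι × Bool) : letter x (invLetter s) = (letter x s)⁻¹ := by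
  obtain ⟨i, _ | _⟩ := s <;> simp [letter, invLetter]

theorem invLetter_invLetter (s : ι × Bool) : invLetter (invLetter s) = s := by
  simp [invLetter]

theorem invLetter_ne (s : ι × Bool) : invLetter s ≠ s := by
  simp [invLetter, Prod.ext_iff]

theorem eq_invLetter_of_fst_eq {s t : ι × Bool} (h : s.1 = t.1) (hne : s ≠ t) :
    s = invLetter t := by
  obtain ⟨i, _ | _⟩ := s <;> obtain ⟨j, _ | _⟩ := t <;> simp_all [invLetter]

theorem map_letter (f : G →* H) (x : ι → G) (s : ι × Bool) : f (letter x s) = letter (f ∘ x) s := by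
  obtain ⟨i, _ | _⟩ := s <;> simp [letter]

theorem wordValue_nil (x : ι → G) : wordValue x [] = 1 := rfl

theorem wordValue_cons (x : ι → G) (s : ι × Bool) (l : List (ι × Bool)) :
    wordValue x (s :: l) = letter x s * wordValue x l :=
  List.prod_cons

theorem wordValue_append (x : ι → G) (l₁ l₂ : List (ι × Bool)) :
    wordValue x (l₁ ++ l₂) = wordValue x l₁ * wordValue x l₂ := by
  simp [wordValue]

theorem lift_mk_eq_wordValue (x : ι → G) (l : List (ι × Bool)) :
    FreeGroup.lift x (FreeGroup.mk l) = wordValue x l :=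
  FreeGroup.lift_mk

theorem wordValue_invRev (x : ι → G) (l : List (ι × Bool)) :
    wordValue x (FreeGroup.invRev l) = (wordValue x l)⁻¹ := by
  rw [← lift_mk_eq_wordValue, ← FreeGroup.inv_mk, map_inv, lift_mk_eq_wordValue]

theorem map_wordValue (f : G →* H) (x : ι → G) (l : List (ι × Bool)) :
    f (wordValue x l) = wordValue (f ∘ x) l := by
  simp only [wordValue, map_list_prod, List.map_map]
  exact congrArg List.prod (List.map_congr_left fun s _ => map_letter f x s)

theorem wordValue_congr {x y : ι → G} {l : List (ι × Bool)} (h : ∀ s ∈ l, x s.1 = y s.1) :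
    wordValue x l = wordValue y l :=
  congrArg List.prod <| List.map_congr_left fun s hs => by simp only [letter, h s hs]

theorem wordValue_map_index (x : κ → G) (f : ι → κ) (l : List (ι × Bool)) :
    wordValue x (l.map (Prod.map f id)) = wordValue (x ∘ f) l := by
  rw [wordValue, List.map_map]
  rfl

theorem wordValue_map_pair [DecidableEq ι] (x : ι → G) (i j : ι) {l : List (ι × Bool)}
    (hl : ∀ s ∈ l, s.1 = i ∨ s.1 = j) :
    wordValue (x ∘ ![i, j]) (l.map (Prod.map (fun k => if k = i then 0 else 1) id)) =
      wordValue x l := by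
  rw [wordValue_map_index]
  refine wordValue_congr fun s hs => ?_
  by_cases hi : s.1 = i
  · simp [hi]
  · rw [Function.comp_apply, Function.comp_apply, if_neg hi]
    exact congrArg x ((hl s hs).resolve_left hi).symm

theorem exists_wordValue_eq {x : ι → G} (hx : Subgroup.closure (Set.range x) = ⊤) (g : G) :
    ∃ l, wordValue x l = g := by
  obtain ⟨⟨l⟩, hl⟩ := FreeGroup.lift_surjective_iff_closure_range_eq_top.2 hx g
  exact ⟨l, (lift_mk_eq_wordValue x l).symm.trans hl⟩

theorem even_length_of_freeGroup_mk_eq_one {l : List (ι × Bool)} (h : FreeGroup.mk l = 1) :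
    Even l.length := by
  obtain ⟨l', hl, hnil⟩ := FreeGroup.Red.exact.1 (h.trans FreeGroup.one_eq_mk)
  obtain ⟨n, hn⟩ := hl.length
  rw [FreeGroup.Red.nil_iff.1 hnil, List.length_nil, zero_add] at hn
  exact hn ▸ even_two_mul n

theorem wordValue_mem_closure {x : ι → G} {i : ι} {l : List (ι × Bool)}
    (h : i ∉ l.map Prod.fst) : wordValue x l ∈ Subgroup.closure (x '' {i}ᶜ) := by
  refine Subgroup.list_prod_mem _ fun g hg => ?_
  obtain ⟨⟨j, ε⟩, hs, rfl⟩ := List.mem_map.1 hg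
  have hj : j ≠ i := fun hj => h (hj ▸ List.mem_map_of_mem hs)
  have hmem : x j ∈ Subgroup.closure (x '' {i}ᶜ) := Subgroup.subset_closure ⟨j, hj, rfl⟩
  cases ε
  · exact inv_mem hmem
  · exact hmem

/-- Solving the relation for the single occurrence of `x i` would put `x i` in the subgroup
generated by the others. -/
theorem count_ne_one_of_wordValue_eq_one [DecidableEq ι] {x : ι → G} {i : ι}
    (hi : x i ∉ Subgroup.closure (x '' {i}ᶜ)) {l : List (ι × Bool)} (hl : wordValue x l = 1) :
    (l.map Prod.fst).count i ≠ 1 := by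
  intro hcount
  obtain ⟨⟨j, ε⟩, hs, hj⟩ := List.mem_map.1 (List.count_pos_iff.1 (hcount ▸ one_pos))
  obtain rfl : j = i := hj
  obtain ⟨l₁, l₂, rfl⟩ := List.append_of_mem hs
  simp only [List.map_append, List.map_cons, List.count_append, List.count_cons_self] at hcount
  have h₁ : j ∉ l₁.map Prod.fst := List.count_eq_zero.1 (by omega)
  have h₂ : j ∉ l₂.map Prod.fst := List.count_eq_zero.1 (by omega)
  have hsolve : letter x (j, ε) = (wordValue x l₁)⁻¹ * (wordValue x l₂)⁻¹ := by
    rw [eq_mul_inv_iff_mul_eq, eq_inv_iff_mul_eq_one, mul_eq_one_comm, ← hl, wordValue_append,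
      wordValue_cons]
  have hmem : letter x (j, ε) ∈ Subgroup.closure (x '' {j}ᶜ) := hsolve ▸
    mul_mem (inv_mem (wordValue_mem_closure h₁)) (inv_mem (wordValue_mem_closure h₂))
  cases ε
  · exact hi (inv_mem_iff.1 hmem)
  · exact hi hmem

end Words

theorem two_mul_card_toFinset_le_length {α : Type*} [DecidableEq α] {l : List α}
    (h : ∀ a, l.count a ≠ 1) : 2 * l.toFinset.card ≤ l.length := by
  rw [← List.sum_toFinset_count_eq_length, mul_comm, ← smul_eq_mul]
  refine Finset.card_nsmul_le_sum _ _ _ fun a ha => ?_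
  have hpos := List.count_pos_iff.2 (List.mem_toFinset.1 ha)
  have := h a
  omega

/-! ### Amalgamated products -/

section Amalgam

open Monoid

variable {ι H : Type*} {G : ι → Type*} [Group H] [∀ i, Group (G i)] {φ : ∀ i, H →* G i}

theorem coprodI_eq_one_of_lift_mem_range_base {K : ι → Type*} [∀ i, Monoid (K i)]
    (hφ : ∀ i, Function.Injective (φ i)) (f : ∀ i, K i →* G i)
    (hf : ∀ i k, f i k ∈ (φ i).range → k = 1) {x : CoprodI K}
    (hx : CoprodI.lift (fun i => (PushoutI.of (φ := φ) i).comp (f i)) x ∈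
      (PushoutI.base φ).range) : x = 1 := by
  classical
  obtain ⟨w, rfl⟩ := (CoprodI.Word.equiv (M := K)).symm.surjective x
  change CoprodI.lift _ w.prod ∈ _ at hx
  let w' : CoprodI.Word G :=
    { toList := w.toList.map fun g => ⟨g.1, f g.1 g.2⟩
      ne_one := by
        rintro _ hl h
        obtain ⟨g, hg, rfl⟩ := List.mem_map.1 hl
        exact w.ne_one g hg (hf _ _ (by rw [show f g.1 g.2 = 1 from h]; exact one_mem _))
      chain_ne := by
        rw [List.isChain_map]
        exact w.chain_ne }
  have hred : PushoutI.Reduced φ w' := by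
    rintro _ hl h
    obtain ⟨g, hg, rfl⟩ := List.mem_map.1 hl
    exact w.ne_one g hg (hf _ _ h)
  have hprod : PushoutI.ofCoprodI w'.prod =
      CoprodI.lift (fun i => (PushoutI.of (φ := φ) i).comp (f i)) w.prod := by
    simp only [CoprodI.Word.prod, map_list_prod, w', List.map_map]
    exact congrArg List.prod (List.map_congr_left fun g _ => by simp)
  have hempty : w'.toList = [] :=
    congrArg CoprodI.Word.toList (hred.eq_empty_of_mem_range hφ (hprod ▸ hx))
  have hw : w = CoprodI.Word.empty := CoprodI.Word.ext (List.map_eq_nil_iff.1 hempty)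
  change w.prod = 1
  rw [hw, CoprodI.Word.prod_empty]

theorem freeGroup_eq_one_of_lift_mem_range_base (hφ : ∀ i, Function.Injective (φ i))
    (g : ∀ i, G i) (hg : ∀ i (n : ℤ), g i ^ n ∈ (φ i).range → n = 0) {w : FreeGroup ι}
    (hw : FreeGroup.lift (fun i => PushoutI.of (φ := φ) i (g i)) w ∈
      (PushoutI.base φ).range) : w = 1 := by
  have hlift : FreeGroup.lift (fun i => PushoutI.of (φ := φ) i (g i)) =
      (CoprodI.lift fun i =>
        (PushoutI.of (φ := φ) i).comp (FreeGroup.lift fun _ : Unit => g i)).comp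
          (freeGroupEquivCoprodI (ι := ι)).toMonoidHom := by
    ext i
    simp
  rw [hlift, MonoidHom.comp_apply] at hw
  refine (map_eq_one_iff _ (freeGroupEquivCoprodI (ι := ι)).injective).1
    (coprodI_eq_one_of_lift_mem_range_base hφ _ (fun i k hk => ?_) hw)
  obtain ⟨n, rfl⟩ := FreeGroup.freeGroupUnitEquivInt.symm.surjective k
  change FreeGroup.lift (fun _ => g i) (FreeGroup.of () ^ n) ∈ _ at hk
  rw [map_zpow, FreeGroup.lift_apply_of] at hk
  rw [hg i n hk]
  rfl

end Amalgam

/-! ### The affine group of the rational line -/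

namespace Higman

open Monoid

/-- The dilation `t ↦ t / 2` of the rational line. With `translation` it generates a copy of the
Baumslag-Solitar group `⟨a, b | a⁻¹ b a = b²⟩`. -/
def dilation : Equiv.Perm ℚ := Equiv.mulLeft₀ (1 / 2) (by norm_num)

/-- The translation `t ↦ t + 1` of the rational line. -/
def translation : Equiv.Perm ℚ := Equiv.addRight 1

theorem dilation_apply (t : ℚ) : dilation t = 1 / 2 * t := rfl

theorem dilation_inv_apply (t : ℚ) : dilation⁻¹ t = 2 * t := by
  rw [Equiv.Perm.inv_eq_iff_eq, dilation_apply]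
  ring

theorem translation_apply (t : ℚ) : translation t = t + 1 := rfl

theorem translation_inv_apply (t : ℚ) : translation⁻¹ t = t - 1 := by
  rw [Equiv.Perm.inv_eq_iff_eq, translation_apply]
  ring

theorem dilation_inv_mul_translation_mul_dilation :
    dilation⁻¹ * translation * dilation = translation ^ 2 := by
  ext t
  simp only [Equiv.Perm.mul_apply, pow_two, dilation_apply, dilation_inv_apply, translation_apply]
  ring

theorem dilation_zpow_apply (n : ℤ) (t : ℚ) : (dilation ^ n) t = (1 / 2) ^ n * t := by
  induction n generalizing t with
  | zero => simp
  | succ n ih =>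
    rw [zpow_add_one, Equiv.Perm.mul_apply, ih, dilation_apply, zpow_add_one₀ (by norm_num)]
    ring
  | pred n ih =>
    rw [zpow_sub_one, Equiv.Perm.mul_apply, ih, dilation_inv_apply, zpow_sub_one₀ (by norm_num)]
    ring

theorem translation_zpow_apply (n : ℤ) (t : ℚ) : (translation ^ n) t = t + n := by
  induction n generalizing t with
  | zero => simp
  | succ n ih =>
    rw [zpow_add_one, Equiv.Perm.mul_apply, ih, translation_apply]
    push_cast
    ring
  | pred n ih =>
    rw [zpow_sub_one, Equiv.Perm.mul_apply, ih, translation_inv_apply]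
    push_cast
    ring

theorem eq_zero_of_dilation_zpow_eq_translation_zpow {m n : ℤ}
    (h : dilation ^ m = translation ^ n) : m = 0 ∧ n = 0 := by
  have h₀ := Equiv.congr_fun h 0
  have h₁ := Equiv.congr_fun h 1
  rw [dilation_zpow_apply, translation_zpow_apply] at h₀ h₁
  obtain rfl : n = 0 := by simpa using h₀.symm
  have hm : (1 / 2 : ℚ) ^ m = (1 / 2) ^ (0 : ℤ) := by simpa using h₁
  exact ⟨zpow_right_injective₀ (by norm_num) (by norm_num) hm, rfl⟩

/-- An affine map is determined by its values at `0` and `1`, so this is a finite computation. -/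
theorem eq_of_affine_wordValue_eq_one {s x y z : Fin 2 × Bool}
    (h : wordValue ![dilation, translation] [s, s, x, y, z] = 1) : s.1 = 1 ∧ x = (0, false) := by
  have key : ∀ s x y z : Fin 2 × Bool,
      wordValue ![dilation, translation] [s, s, x, y, z] 0 = 0 →
      wordValue ![dilation, translation] [s, s, x, y, z] 1 = 1 → s.1 = 1 ∧ x = (0, false) := by
    decide +kernel
  exact key s x y z (Equiv.congr_fun h 0) (Equiv.congr_fun h 1)

/-! ### An amalgam in which the Higman group is represented -/

/-- The generator of the `i`-th affine group that is identified with its counterpart in the other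
affine group. -/
def innerGen : Fin 2 → Equiv.Perm ℚ := ![translation, dilation]

/-- The generator of the `i`-th affine group complementary to `innerGen i`. -/
def outerGen : Fin 2 → Equiv.Perm ℚ := ![dilation, translation]

theorem eq_zero_of_outerGen_zpow_eq_innerGen_zpow {i : Fin 2} {m n : ℤ}
    (h : outerGen i ^ m = innerGen i ^ n) : m = 0 ∧ n = 0 := by
  fin_cases i
  · exact eq_zero_of_dilation_zpow_eq_translation_zpow h
  · exact (eq_zero_of_dilation_zpow_eq_translation_zpow h.symm).symm

/-- The embeddings of the infinite cyclic group along which two affine groups are amalgamated. -/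
def innerHom (i : Fin 2) : Multiplicative ℤ →* Equiv.Perm ℚ := zpowersHom _ (innerGen i)

theorem innerHom_injective (i : Fin 2) : Function.Injective (innerHom i) :=
  (injective_iff_map_eq_one _).2 fun _ hn =>
    (eq_zero_of_outerGen_zpow_eq_innerGen_zpow ((zpow_zero _).trans hn.symm)).2

/-- The amalgam of two affine groups in which `⟨a, b, c⟩` is represented: the generator `b` is the
translation of the first factor and the dilation of the second. -/
abbrev TripleModel : Type := PushoutI innerHom

/-- The inclusions of the two affine groups. -/
abbrev tripleOf (i : Fin 2) : Equiv.Perm ℚ →* TripleModel :=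
  PushoutI.of (G := fun _ : Fin 2 => Equiv.Perm ℚ) i

theorem tripleOf_innerGen (i : Fin 2) :
    tripleOf i (innerGen i) = PushoutI.base innerHom (Multiplicative.ofAdd 1) := by
  rw [← PushoutI.of_apply_eq_base innerHom i]
  exact congrArg _ (zpow_one _).symm

theorem tripleOf_translation_eq_tripleOf_dilation : tripleOf 0 translation = tripleOf 1 dilation :=
  (tripleOf_innerGen 0).trans (tripleOf_innerGen 1).symm

/-- The homomorphism from the free group of rank two to `TripleModel` with image `⟨a, c⟩`. -/
def outerFreeHom : FreeGroup (Fin 2) →* TripleModel :=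
  FreeGroup.lift fun i => tripleOf i (outerGen i)

theorem eq_one_of_outerFreeHom_mem_range_base {w : FreeGroup (Fin 2)}
    (hw : outerFreeHom w ∈ (PushoutI.base innerHom).range) : w = 1 :=
  freeGroup_eq_one_of_lift_mem_range_base innerHom_injective outerGen
    (fun _ _ ⟨_, hn⟩ => (eq_zero_of_outerGen_zpow_eq_innerGen_zpow hn.symm).1) hw

theorem outerFreeHom_injective : Function.Injective outerFreeHom :=
  (injective_iff_map_eq_one _).2 fun _ hw =>
    eq_one_of_outerFreeHom_mem_range_base (hw ▸ one_mem _)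

theorem tripleOf_translation_notMem_range : tripleOf 0 translation ∉ outerFreeHom.range := by
  rintro ⟨w, hw⟩
  have hbase := hw.trans (tripleOf_innerGen 0)
  obtain rfl := eq_one_of_outerFreeHom_mem_range_base ⟨_, hbase.symm⟩
  rw [map_one, eq_comm, map_eq_one_iff _ (PushoutI.base_injective innerHom_injective)] at hbase
  exact one_ne_zero (α := ℤ) (congrArg Multiplicative.toAdd hbase)

/-- The two embeddings of the free group of rank two along which two copies of `TripleModel`
are amalgamated; they differ by the exchange of the two free generators. -/
def amalgamHom (k : Fin 2) : FreeGroup (Fin 2) →* TripleModel :=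
  outerFreeHom.comp (FreeGroup.freeGroupCongr (Equiv.addRight k)).toMonoidHom

theorem amalgamHom_of (k i : Fin 2) :
    amalgamHom k (FreeGroup.of i) = tripleOf (i + k) (outerGen (i + k)) := by
  simp [amalgamHom, outerFreeHom]

theorem amalgamHom_injective (k : Fin 2) : Function.Injective (amalgamHom k) :=
  outerFreeHom_injective.comp (FreeGroup.freeGroupCongr (Equiv.addRight k)).injective

/-- An amalgam of two copies of `TripleModel`, for `⟨a, b, c⟩` and `⟨c, d, a⟩`, over the free group
on `a` and `c`. -/
abbrev Model : Type := PushoutI amalgamHom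

/-- The inclusions of the two copies of `TripleModel`. -/
abbrev modelOf (k : Fin 2) : TripleModel →* Model :=
  PushoutI.of (G := fun _ : Fin 2 => TripleModel) k

/-- The images of the generators of the Higman group in `Model`. -/
def modelGen : Fin 4 → Model :=
  ![modelOf 0 (tripleOf 0 dilation), modelOf 0 (tripleOf 0 translation),
    modelOf 1 (tripleOf 0 dilation), modelOf 1 (tripleOf 0 translation)]

theorem modelOf_tripleOf_outerGen (k i : Fin 2) :
    modelOf k (tripleOf (i + k) (outerGen (i + k))) =
      PushoutI.base amalgamHom (FreeGroup.of i) := by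
  rw [← amalgamHom_of, PushoutI.of_apply_eq_base]

theorem modelGen_zero_eq_base : modelGen 0 = PushoutI.base amalgamHom (FreeGroup.of 0) :=
  modelOf_tripleOf_outerGen 0 0

theorem modelGen_two_eq_base : modelGen 2 = PushoutI.base amalgamHom (FreeGroup.of 1) :=
  modelOf_tripleOf_outerGen 1 1

theorem modelGen_zero_eq : modelGen 0 = modelOf 1 (tripleOf 1 translation) :=
  modelGen_zero_eq_base.trans (modelOf_tripleOf_outerGen 1 0).symm

theorem modelGen_two_eq : modelGen 2 = modelOf 0 (tripleOf 1 translation) :=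
  modelGen_two_eq_base.trans (modelOf_tripleOf_outerGen 0 1).symm

theorem modelGen_rel (i : Fin 4) :
    (modelGen i)⁻¹ * modelGen (i + 1) * modelGen i * (modelGen (i + 1) ^ 2)⁻¹ = 1 := by
  have affine (k j : Fin 2) (x y : Model) (hx : x = modelOf k (tripleOf j dilation))
      (hy : y = modelOf k (tripleOf j translation)) : x⁻¹ * y * x * (y ^ 2)⁻¹ = 1 := by
    rw [hx, hy, mul_inv_eq_one]
    simp only [← map_inv, ← map_mul, ← map_pow, dilation_inv_mul_translation_mul_dilation]
  have hbc := congrArg (modelOf 0) tripleOf_translation_eq_tripleOf_dilation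
  have hda := congrArg (modelOf 1) tripleOf_translation_eq_tripleOf_dilation
  fin_cases i
  · exact affine 0 0 _ _ rfl rfl
  · exact affine 0 1 _ _ hbc modelGen_two_eq
  · exact affine 1 0 _ _ rfl rfl
  · exact affine 1 1 _ _ hda modelGen_zero_eq

/-- The representation of the Higman group in the amalgam. -/
def toModel : HigmanGroup →* Model :=
  PresentedGroup.toGroup (f := modelGen) (by
    rintro _ ⟨i, rfl⟩
    simpa using modelGen_rel i)

theorem toModel_gen (i : Fin 4) : toModel (gen i) = modelGen i :=
  PresentedGroup.toGroup.of _

theorem modelGen_mem_range_of_ne_three {i : Fin 4} (hi : i ≠ 3) :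
    modelGen i ∈ (modelOf 0).range := by
  fin_cases i
  · exact ⟨_, rfl⟩
  · exact ⟨_, rfl⟩
  · exact ⟨_, modelGen_two_eq.symm⟩
  · exact absurd rfl hi

theorem modelGen_three_notMem_range : modelGen 3 ∉ (modelOf 0).range := by
  intro h
  have hbase : modelGen 3 ∈ (PushoutI.base amalgamHom).range := by
    rw [← PushoutI.inf_of_range_eq_base_range amalgamHom_injective (zero_ne_one (α := Fin 2))]
    exact ⟨h, _, rfl⟩
  obtain ⟨w, hw⟩ := hbase
  rw [← PushoutI.of_apply_eq_base amalgamHom 1] at hw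
  exact tripleOf_translation_notMem_range
    ⟨_, PushoutI.of_injective amalgamHom_injective 1 hw⟩

/-! ### Independence of the generators -/

theorem gen_three_notMem_closure : gen 3 ∉ Subgroup.closure (gen '' {3}ᶜ) := by
  intro h
  have hle : Subgroup.closure (gen '' {3}ᶜ) ≤
      Subgroup.comap (N := Model) toModel (modelOf 0).range := by
    rw [Subgroup.closure_le]
    rintro _ ⟨i, hi, rfl⟩
    change toModel (gen i) ∈ (modelOf 0).range
    exact (toModel_gen i).symm ▸ modelGen_mem_range_of_ne_three hi
  exact modelGen_three_notMem_range ((toModel_gen 3).symm ▸ hle h)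

theorem gen_notMem_closure (i : Fin 4) : gen i ∉ Subgroup.closure (gen '' {i}ᶜ) := by
  intro h
  have hle : Subgroup.closure (gen '' {i}ᶜ) ≤
      (Subgroup.closure (gen '' {3}ᶜ)).comap (rotationHom (3 - i)) := by
    rw [Subgroup.closure_le]
    rintro _ ⟨j, hj, rfl⟩
    refine Subgroup.subset_closure ⟨_, ?_, (rotationHom_gen _ _).symm⟩
    exact fun hj' => hj (by simpa [add_sub_left_comm, sub_eq_zero] using hj')
  have hmem := hle h
  rw [Subgroup.mem_comap, rotationHom_gen, add_sub_cancel] at hmem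
  exact gen_three_notMem_closure hmem

theorem lift_gen_pair_add_two_injective (i : Fin 4) :
    Function.Injective (FreeGroup.lift (gen ∘ ![i, i + 2])) := by
  have hbase : (toModel.comp (rotationHom (-i))).comp (FreeGroup.lift (gen ∘ ![i, i + 2])) =
      PushoutI.base amalgamHom := by
    ext j
    fin_cases j
    · simp [rotationHom_gen, toModel_gen, modelGen_zero_eq_base]
    · simp [rotationHom_gen, toModel_gen, modelGen_two_eq_base]
  refine Function.Injective.of_comp (f := toModel.comp (rotationHom (-i))) ?_
  rw [← MonoidHom.coe_comp, hbase]
  exact PushoutI.base_injective amalgamHom_injective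

theorem affine_wordValue_eq_one_of_gen {i : Fin 4} {l : List (Fin 2 × Bool)}
    (h : wordValue (gen ∘ ![i, i + 1]) l = 1) : wordValue ![dilation, translation] l = 1 := by
  have hmodel : (toModel.comp (rotationHom (-i))) ∘ gen ∘ ![i, i + 1] =
      ((modelOf 0).comp (tripleOf 0)) ∘ ![dilation, translation] := by
    ext j
    fin_cases j
    · simp [rotationHom_gen, toModel_gen, modelGen]
    · simp [rotationHom_gen, toModel_gen, modelGen]
  have hinj : Function.Injective ((modelOf 0).comp (tripleOf 0)) :=
    (PushoutI.of_injective amalgamHom_injective 0).comp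
      (PushoutI.of_injective innerHom_injective 0)
  apply hinj
  calc ((modelOf 0).comp (tripleOf 0)) (wordValue ![dilation, translation] l)
    _ = wordValue ((toModel.comp (rotationHom (-i))) ∘ gen ∘ ![i, i + 1]) l :=
      (map_wordValue (H := Model) _ _ l).trans (by rw [hmodel])
    _ = toModel (rotationHom (-i) (wordValue (gen ∘ ![i, i + 1]) l)) :=
      (map_wordValue (H := Model) (toModel.comp (rotationHom (-i))) _ l).symm
    _ = ((modelOf 0).comp (tripleOf 0)) 1 := by rw [h, map_one, map_one, map_one]

end Higman

/-! ### Short words -/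

namespace Higman

theorem even_length_of_wordValue_gen_eq_one {i : Fin 4} {l : List (Fin 4 × Bool)}
    (hl : ∀ s ∈ l, s.1 = i ∨ s.1 = i + 2) (h : wordValue gen l = 1) : Even l.length := by
  rw [← wordValue_map_pair gen i (i + 2) hl, ← lift_mk_eq_wordValue,
    map_eq_one_iff _ (lift_gen_pair_add_two_injective i)] at h
  simpa only [List.length_map] using even_length_of_freeGroup_mk_eq_one h

theorem fst_eq_or_fst_eq_of_wordValue_gen_eq_one {s t : Fin 4 × Bool} {l : List (Fin 4 × Bool)}
    (h : wordValue gen l = 1) (hlen : l.length ≤ 5) (hs : s ∈ l) (ht : t ∈ l) (hst : s.1 ≠ t.1) :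
    ∀ r ∈ l, r.1 = s.1 ∨ r.1 = t.1 := by
  have hcard : 2 * (l.map Prod.fst).toFinset.card ≤ l.length :=
    (two_mul_card_toFinset_le_length fun i =>
      count_ne_one_of_wordValue_eq_one (gen_notMem_closure i) h).trans_eq (List.length_map _)
  have hmem {r : Fin 4 × Bool} (hr : r ∈ l) : r.1 ∈ (l.map Prod.fst).toFinset :=
    List.mem_toFinset.2 (List.mem_map_of_mem hr)
  have hpair : {s.1, t.1} = (l.map Prod.fst).toFinset :=
    Finset.eq_of_subset_of_card_le (Finset.insert_subset (hmem hs) (by simpa using hmem ht))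
      (by rw [Finset.card_pair hst]; omega)
  intro r hr
  simpa [← hpair] using hmem hr

theorem wordValue_gen_ne_one_of_opposite {s t : Fin 4 × Bool} (hst : t.1 = s.1 + 2)
    (x y z : Fin 4 × Bool) : wordValue gen [s, t, x, y, z] ≠ 1 := by
  intro h
  have hne : s.1 ≠ t.1 := by simp [hst]
  have hl := fst_eq_or_fst_eq_of_wordValue_gen_eq_one h le_rfl (by simp) (by simp) hne
  exact absurd (even_length_of_wordValue_gen_eq_one (fun r hr => hst ▸ hl r hr) h)
    (show ¬ Even 5 by decide)

theorem eq_of_adjacent_wordValue_gen_eq_one {i : Fin 4} {s x y z : Fin 4 × Bool}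
    (hl : ∀ r ∈ [s, s, x, y, z], r.1 = i ∨ r.1 = i + 1)
    (h : wordValue gen [s, s, x, y, z] = 1) : s.1 ≠ i ∧ x = (i, false) := by
  rw [← wordValue_map_pair gen i (i + 1) hl] at h
  obtain ⟨hs, hx⟩ := eq_of_affine_wordValue_eq_one (affine_wordValue_eq_one_of_gen h)
  have hi : ∀ r : Fin 4 × Bool, (if r.1 = i then (0 : Fin 2) else 1) = 0 → r.1 = i := by
    intro r hr
    by_contra hne
    simp [hne] at hr
  refine ⟨fun hsi => ?_, Prod.ext (hi x (Prod.ext_iff.1 hx).1) (Prod.ext_iff.1 hx).2⟩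
  simp [hsi] at hs

theorem eq_of_sq_wordValue_gen_eq_one {s x y z : Fin 4 × Bool}
    (h : wordValue gen [s, s, x, y, z] = 1) : x = (s.1 - 1, false) := by
  obtain ⟨j, hj, hl⟩ : ∃ j ≠ s.1, ∀ r ∈ [s, s, x, y, z], r.1 = s.1 ∨ r.1 = j := by
    by_cases hall : ∀ r ∈ [s, s, x, y, z], r.1 = s.1
    · exact ⟨s.1 + 1, by simp, fun r hr => Or.inl (hall r hr)⟩
    · push Not at hall
      obtain ⟨r, hr, hrs⟩ := hall
      exact ⟨r.1, hrs,
        fst_eq_or_fst_eq_of_wordValue_gen_eq_one h le_rfl List.mem_cons_self hr hrs.symm⟩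
  have hcases : ∀ i j : Fin 4, j ≠ i → j = i + 1 ∨ j = i + 2 ∨ i = j + 1 := by decide
  rcases hcases s.1 j hj with rfl | rfl | hs
  · exact absurd rfl (eq_of_adjacent_wordValue_gen_eq_one hl h).1
  · exact absurd (even_length_of_wordValue_gen_eq_one hl h) (show ¬ Even 5 by decide)
  · rw [hs, add_sub_cancel_right]
    exact (eq_of_adjacent_wordValue_gen_eq_one (fun r hr => hs ▸ (hl r hr).symm) h).2

theorem letter_gen_ne_one (s : Fin 4 × Bool) : letter gen s ≠ 1 := fun h =>
  count_ne_one_of_wordValue_eq_one (gen_notMem_closure s.1) (l := [s])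
    (by rw [wordValue_cons, h, wordValue_nil, one_mul]) (by simp)

theorem gen_inv_mul_letter_mul_gen (s : Fin 4 × Bool) :
    (gen (s.1 - 1))⁻¹ * letter gen s * gen (s.1 - 1) = letter gen s * letter gen s := by
  have hrel := mul_inv_eq_one.1 (gen_rel (s.1 - 1))
  rw [sub_add_cancel, pow_two] at hrel
  obtain ⟨i, _ | _⟩ := s
  · calc (gen (i - 1))⁻¹ * (gen i)⁻¹ * gen (i - 1)
      _ = ((gen (i - 1))⁻¹ * gen i * gen (i - 1))⁻¹ := by group
      _ = (gen i)⁻¹ * (gen i)⁻¹ := (congrArg _ hrel).trans (mul_inv_rev _ _)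
  · exact hrel

theorem letter_gen_injective : Function.Injective (letter gen) := by
  intro s t h
  by_contra hne
  by_cases hst : s.1 = t.1
  · have hsq : letter gen s * letter gen s = 1 := by
      nth_rw 1 [eq_invLetter_of_fst_eq hst hne]
      rw [letter_invLetter, h, inv_mul_cancel]
    have hconj := gen_inv_mul_letter_mul_gen s
    rw [hsq, mul_eq_one_iff_eq_inv, mul_eq_left] at hconj
    exact letter_gen_ne_one s hconj
  · refine count_ne_one_of_wordValue_eq_one (gen_notMem_closure s.1) (l := [s, invLetter t]) ?_ ?_
    · simp only [wordValue_cons, wordValue_nil, letter_invLetter, h, mul_one, mul_inv_cancel]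
    · simp [invLetter, Ne.symm hst]

end Higman

/-! ### Automorphisms of Cayley graphs -/

section Labelling

variable {ι G : Type*} [Group G] {x : ι → G} {φ ψ : G → G} {ℓ m : G → ι × Bool → ι × Bool}

/-- The family `ℓ` describes the action of `φ` on the edges of the Cayley graph of the `x i`: the
edge at `v` labelled by `s` is mapped to the edge at `φ v` labelled by `ℓ v s`. -/
def IsLabelling (x : ι → G) (φ : G → G) (ℓ : G → ι × Bool → ι × Bool) : Prop :=
  ∀ v s, φ (v * letter x s) = φ v * letter x (ℓ v s)

/-- The edges labelled `s` and `t` at a vertex are consecutive edges of a closed walk of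
length five. -/
def IsPentagonCorner (x : ι → G) (s t : ι × Bool) : Prop :=
  ∃ l : List (ι × Bool), l.length = 3 ∧ letter x t = letter x s * wordValue x l

theorem IsPentagonCorner.symm {s t : ι × Bool} (h : IsPentagonCorner x s t) :
    IsPentagonCorner x t s := by
  obtain ⟨l, hlen, hl⟩ := h
  exact ⟨FreeGroup.invRev l, by rw [FreeGroup.invRev_length, hlen],
    by rw [hl, wordValue_invRev, mul_inv_cancel_right]⟩

theorem IsLabelling.exists_map_mul_wordValue (hφ : IsLabelling x φ ℓ) (v : G)
    (l : List (ι × Bool)) :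
    ∃ l' : List (ι × Bool), l'.length = l.length ∧
      φ (v * wordValue x l) = φ v * wordValue x l' := by
  induction l generalizing v with
  | nil => exact ⟨[], rfl, by simp only [wordValue_nil, mul_one]⟩
  | cons s l ih =>
    obtain ⟨l', hlen, hl'⟩ := ih (v * letter x s)
    refine ⟨ℓ v s :: l', by rw [List.length_cons, hlen, List.length_cons], ?_⟩
    rw [wordValue_cons, wordValue_cons, ← mul_assoc, hl', hφ, mul_assoc]

theorem IsLabelling.isPentagonCorner (hφ : IsLabelling x φ ℓ) (v : G) {s t : ι × Bool}
    (h : IsPentagonCorner x s t) : IsPentagonCorner x (ℓ v s) (ℓ v t) := by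
  obtain ⟨l, hlen, hl⟩ := h
  obtain ⟨l', hlen', hl'⟩ := hφ.exists_map_mul_wordValue (v * letter x s) l
  refine ⟨l', hlen'.trans hlen, ?_⟩
  rwa [mul_assoc, ← hl, hφ, hφ, mul_assoc, mul_right_inj] at hl'

theorem IsLabelling.leftInverse (hx : Function.Injective (letter x)) (hφ : IsLabelling x φ ℓ)
    (hψ : IsLabelling x ψ m) (hψφ : Function.LeftInverse ψ φ) (v : G) :
    Function.LeftInverse (m (φ v)) (ℓ v) := fun s =>
  hx (mul_left_cancel (a := v) (by rw [← hψφ (v * letter x s), hφ, hψ, hψφ]))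

theorem IsLabelling.apply_mul_letter_invLetter (hx : Function.Injective (letter x))
    (hφ : IsLabelling x φ ℓ) (v : G) (s : ι × Bool) :
    ℓ (v * letter x s) (invLetter s) = invLetter (ℓ v s) := by
  have h := hφ (v * letter x s) (invLetter s)
  rw [letter_invLetter, mul_inv_cancel_right, hφ, mul_assoc, left_eq_mul,
    mul_eq_one_iff_inv_eq, ← letter_invLetter] at h
  exact (hx h).symm

end Labelling

namespace Higman

/-! ### Automorphisms of the Cayley graph of the Higman group -/

theorem mem_generators_iff {g : HigmanGroup} : g ∈ generators ↔ ∃ s, letter gen s = g := by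
  constructor
  · rintro ⟨i, rfl | rfl⟩
    · exact ⟨(i, true), rfl⟩
    · exact ⟨(i, false), rfl⟩
  · rintro ⟨⟨i, _ | _⟩, rfl⟩
    · exact ⟨i, Or.inr rfl⟩
    · exact ⟨i, Or.inl rfl⟩

theorem cayleyGraph_adj_iff {u v : HigmanGroup} :
    cayleyGraph.Adj u v ↔ ∃ s, u * letter gen s = v := by
  rw [cayleyGraph, SimpleGraph.mulCayley_adj']
  constructor
  · rintro ⟨-, g, hg, h⟩
    obtain ⟨s, rfl⟩ := mem_generators_iff.1 hg
    rcases h with h | h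
    · exact ⟨s, h⟩
    · exact ⟨invLetter s, by rw [letter_invLetter, h, mul_inv_cancel_right]⟩
  · rintro ⟨s, rfl⟩
    exact ⟨fun h => letter_gen_ne_one s (left_eq_mul.1 h), letter gen s,
      mem_generators_iff.2 ⟨s, rfl⟩, Or.inl rfl⟩

theorem exists_isLabelling (φ : cayleyGraph ≃g cayleyGraph) : ∃ ℓ, IsLabelling gen φ ℓ := by
  have hadj (v : HigmanGroup) (s : Fin 4 × Bool) :
      ∃ t, φ v * letter gen t = φ (v * letter gen s) :=
    cayleyGraph_adj_iff.1 (φ.map_adj_iff.2 (cayleyGraph_adj_iff.2 ⟨s, rfl⟩))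
  choose ℓ hℓ using hadj
  exact ⟨ℓ, fun v s => (hℓ v s).symm⟩

theorem isPentagonCorner_gen_of_fst_eq {s t : Fin 4 × Bool} (hst : s.1 = t.1) (hne : s ≠ t) :
    IsPentagonCorner gen s t := by
  obtain rfl := eq_invLetter_of_fst_eq hst hne
  refine ⟨[(t.1 - 1, false), t, (t.1 - 1, true)], rfl, ?_⟩
  simp only [wordValue_cons, wordValue_nil, letter_true, letter_false, letter_invLetter, mul_one]
  rw [← mul_assoc (gen _)⁻¹, gen_inv_mul_letter_mul_gen, inv_mul_cancel_left]

theorem isPentagonCorner_gen_sub_one (t : Fin 4 × Bool) (ε : Bool) :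
    IsPentagonCorner gen (t.1 - 1, ε) t := by
  have hrel := gen_inv_mul_letter_mul_gen t
  cases ε
  · refine ⟨[t, (t.1 - 1, true), invLetter t], rfl, ?_⟩
    simp only [wordValue_cons, wordValue_nil, letter_true, letter_false, letter_invLetter, mul_one]
    rw [← mul_assoc, ← mul_assoc, hrel, mul_inv_cancel_right]
  · refine ⟨[t, t, (t.1 - 1, false)], rfl, ?_⟩
    simp only [wordValue_cons, wordValue_nil, letter_true, letter_false, mul_one]
    rw [← mul_assoc (letter gen t), ← hrel]
    group

theorem isPentagonCorner_gen_of_not_opposite {s t : Fin 4 × Bool} (hne : s ≠ t)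
    (hst : t.1 ≠ s.1 + 2) : IsPentagonCorner gen s t := by
  have hcases : ∀ i j : Fin 4, j ≠ i + 2 → i = j ∨ i = j - 1 ∨ j = i - 1 := by decide
  rcases hcases s.1 t.1 hst with h | h | h
  · exact isPentagonCorner_gen_of_fst_eq h hne
  · exact (Prod.ext h rfl : s = (t.1 - 1, s.2)) ▸ isPentagonCorner_gen_sub_one t s.2
  · exact .symm ((Prod.ext h rfl : t = (s.1 - 1, t.2)) ▸ isPentagonCorner_gen_sub_one s t.2)

theorem not_isPentagonCorner_gen_of_opposite {s t : Fin 4 × Bool} (hst : t.1 = s.1 + 2) :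
    ¬ IsPentagonCorner gen s t := by
  rintro ⟨l, hlen, hl⟩
  obtain ⟨x, y, z, rfl⟩ := List.length_eq_three.1 hlen
  refine wordValue_gen_ne_one_of_opposite (s := invLetter t) (t := s) ?_ x y z ?_
  · have hadd : ∀ i : Fin 4, i = i + 2 + 2 := by decide
    rw [invLetter, hst]
    exact hadd s.1
  · rw [wordValue_cons, wordValue_cons, letter_invLetter, ← hl, inv_mul_cancel]

section Labelling

variable {φ : cayleyGraph ≃g cayleyGraph} {ℓ : HigmanGroup → Fin 4 × Bool → Fin 4 × Bool}

theorem fst_labelling_of_opposite (hφ : IsLabelling gen φ ℓ) (v : HigmanGroup)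
    {s t : Fin 4 × Bool} (hst : t.1 = s.1 + 2) : (ℓ v t).1 = (ℓ v s).1 + 2 := by
  obtain ⟨m, hm⟩ := exists_isLabelling φ.symm
  have hinv := hφ.leftInverse letter_gen_injective hm φ.symm_apply_apply v
  by_contra h
  have hne : s ≠ t := by
    rintro rfl
    simp at hst
  have hcorner := hm.isPentagonCorner (φ v)
    (isPentagonCorner_gen_of_not_opposite (hinv.injective.ne hne) h)
  rw [hinv, hinv] at hcorner
  exact not_isPentagonCorner_gen_of_opposite hst hcorner

theorem labelling_invLetter (hφ : IsLabelling gen φ ℓ) (v : HigmanGroup)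
    (s : Fin 4 × Bool) : ℓ v (invLetter s) = invLetter (ℓ v s) := by
  obtain ⟨m, hm⟩ := exists_isLabelling φ.symm
  have hinj := (hφ.leftInverse letter_gen_injective hm φ.symm_apply_apply v).injective
  have hs := fst_labelling_of_opposite hφ v (s := s) (t := (s.1 + 2, true)) rfl
  have hs' := fst_labelling_of_opposite hφ v (s := invLetter s) (t := (s.1 + 2, true)) rfl
  exact eq_invLetter_of_fst_eq (add_right_cancel (hs'.symm.trans hs)) (hinj.ne (invLetter_ne s))

theorem labelling_mul_letter (hφ : IsLabelling gen φ ℓ) (v : HigmanGroup)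
    (s : Fin 4 × Bool) : ℓ (v * letter gen s) s = ℓ v s := by
  rw [← invLetter_invLetter s, labelling_invLetter hφ, invLetter_invLetter,
    hφ.apply_mul_letter_invLetter letter_gen_injective, invLetter_invLetter]

theorem labelling_sub_one (hφ : IsLabelling gen φ ℓ) (v : HigmanGroup)
    (s : Fin 4 × Bool) : ℓ v (s.1 - 1, false) = ((ℓ v s).1 - 1, false) := by
  have hsq : φ (v * letter gen s * letter gen s) =
      φ v * (letter gen (ℓ v s) * letter gen (ℓ v s)) := by
    rw [hφ, hφ, labelling_mul_letter hφ, mul_assoc]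
  obtain ⟨l, hlen, hl⟩ := hφ.exists_map_mul_wordValue (v * letter gen (s.1 - 1, false))
    [s, (s.1 - 1, true)]
  obtain ⟨y, z, rfl⟩ := List.length_eq_two.1 hlen
  have hpath : v * letter gen (s.1 - 1, false) * wordValue gen [s, (s.1 - 1, true)] =
      v * letter gen s * letter gen s := by
    rw [mul_assoc v (letter gen s), ← gen_inv_mul_letter_mul_gen]
    simp only [wordValue_cons, wordValue_nil, letter_true, letter_false, mul_one, mul_assoc]
  rw [hpath, hsq, hφ, mul_assoc, mul_right_inj] at hl
  refine eq_of_sq_wordValue_gen_eq_one (s := invLetter (ℓ v s)) (y := y) (z := z) ?_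
  rw [wordValue_cons, wordValue_cons, wordValue_cons, ← hl, letter_invLetter, inv_mul_cancel_left,
    inv_mul_cancel]

theorem exists_labelling_eq_rotation (hφ : IsLabelling gen φ ℓ) (v : HigmanGroup) :
    ∃ k, ∀ s, ℓ v s = (s.1 + k, s.2) := by
  have hstep (i : Fin 4) : (ℓ v (i, false)).1 + 1 = (ℓ v (i + 1, false)).1 := by
    have h := labelling_sub_one hφ v (i + 1, false)
    rw [add_sub_cancel_right] at h
    rw [h, sub_add_cancel]
  have hfalse (i : Fin 4) : ℓ v (i, false) = (i + (ℓ v (0, false)).1, false) := by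
    refine Prod.ext ?_ ?_
    · have h₀ := hstep 0
      have h₁ := hstep 1
      have h₂ := hstep 2
      fin_cases i <;> grind
    · have h := labelling_sub_one hφ v (i + 1, false)
      rw [add_sub_cancel_right] at h
      rw [h]
  refine ⟨(ℓ v (0, false)).1, ?_⟩
  rintro ⟨i, _ | _⟩
  · exact hfalse i
  · change ℓ v (invLetter (i, false)) = _
    rw [labelling_invLetter hφ, hfalse]
    rfl

end Labelling

theorem rotationHom_letter (k : Fin 4) (s : Fin 4 × Bool) :
    rotationHom k (letter gen s) = letter gen (s.1 + k, s.2) := by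
  rw [map_letter, letter, letter, Function.comp_apply, rotationHom_gen]

theorem closure_range_gen : Subgroup.closure (Set.range gen) = ⊤ :=
  PresentedGroup.closure_range_of relators

theorem exists_apply_eq_mul_rotationHom (φ : cayleyGraph ≃g cayleyGraph) :
    ∃ k, ∀ g, φ g = φ 1 * rotationHom k g := by
  obtain ⟨ℓ, hφ⟩ := exists_isLabelling φ
  obtain ⟨k, hk⟩ := exists_labelling_eq_rotation hφ 1
  have key (l : List (Fin 4 × Bool)) : ∀ v, (∀ s, ℓ v s = (s.1 + k, s.2)) →
      φ (v * wordValue gen l) = φ v * rotationHom k (wordValue gen l) := by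
    induction l with
    | nil => simp [wordValue_nil]
    | cons s l ih =>
      intro v hv
      have hnext : ∀ t, ℓ (v * letter gen s) t = (t.1 + k, t.2) := by
        obtain ⟨k', hk'⟩ := exists_labelling_eq_rotation hφ (v * letter gen s)
        have h := labelling_mul_letter hφ v s
        rw [hk', hv, Prod.mk.injEq, add_right_inj] at h
        exact h.1 ▸ hk'
      rw [wordValue_cons, ← mul_assoc, ih _ hnext, hφ, hv, ← rotationHom_letter, map_mul,
        mul_assoc]
  refine ⟨k, fun g => ?_⟩
  obtain ⟨l, rfl⟩ := exists_wordValue_eq closure_range_gen g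
  simpa using key l 1 hk

end Higman

/-! ### Subgroups of finite index -/

theorem conj_pow_eq_pow_pow {G : Type*} [Group G] {x y : G} {k : ℕ} (h : x⁻¹ * y * x = y ^ k)
    (n : ℕ) : (x ^ n)⁻¹ * y * x ^ n = y ^ k ^ n := by
  induction n with
  | zero => simp
  | succ n ih =>
    calc (x ^ (n + 1))⁻¹ * y * x ^ (n + 1)
      _ = x⁻¹ * ((x ^ n)⁻¹ * y * x ^ n) * x := by
        rw [pow_succ]
        group
      _ = (x⁻¹ * y * x) ^ k ^ n := by
        rw [ih]
        simpa using (conj_pow (a := x⁻¹) (b := y) (i := k ^ n)).symm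
      _ = y ^ k ^ (n + 1) := by rw [h, ← pow_mul, pow_succ']

theorem pow_orderOf_modEq_one_of_conj_eq_pow {G : Type*} [Group G] {x y : G} {k : ℕ}
    (h : x⁻¹ * y * x = y ^ k) : k ^ orderOf x ≡ 1 [MOD orderOf y] := by
  have hconj := conj_pow_eq_pow_pow h (orderOf x)
  rw [pow_orderOf_eq_one, inv_one, one_mul, mul_one] at hconj
  rw [← pow_eq_pow_iff_modEq, ← hconj, pow_one]

/-- The order of `2` modulo `p` divides both `n` and `p - 1`. -/
theorem exists_prime_lt_dvd_of_two_pow_modEq_one {p n : ℕ} (hp : p.Prime) (hn : n ≠ 0)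
    (h : 2 ^ n ≡ 1 [MOD p]) : ∃ q, q.Prime ∧ q < p ∧ q ∣ n := by
  have : Fact p.Prime := ⟨hp⟩
  have hpow : (2 : ZMod p) ^ n = 1 := by exact_mod_cast (ZMod.natCast_eq_natCast_iff _ _ _).2 h
  have hdvd : orderOf (2 : ZMod p) ∣ n := orderOf_dvd_of_pow_eq_one hpow
  have hne_one : orderOf (2 : ZMod p) ≠ 1 := by
    rw [Ne, orderOf_eq_one_iff]
    intro htwo
    exact one_ne_zero (α := ZMod p) (by linear_combination htwo)
  have htwo : (2 : ZMod p) ≠ 0 := fun htwo => zero_ne_one (by rwa [htwo, zero_pow hn] at hpow)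
  have hlt : orderOf (2 : ZMod p) < p :=
    (Nat.le_of_dvd (Nat.sub_pos_of_lt hp.one_lt) (ZMod.orderOf_dvd_card_sub_one htwo)).trans_lt
      (Nat.sub_lt hp.pos one_pos)
  exact ⟨_, Nat.minFac_prime hne_one,
    (Nat.minFac_le (Nat.pos_of_dvd_of_pos hdvd (Nat.pos_of_ne_zero hn))).trans_lt hlt,
    (Nat.minFac_dvd _).trans hdvd⟩

theorem eq_one_of_two_pow_modEq_one {ι : Type*} {σ : ι → ι} {n : ι → ℕ}
    (hσ : Function.Surjective σ) (hn : ∀ i, n i ≠ 0) (h : ∀ i, 2 ^ n i ≡ 1 [MOD n (σ i)])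
    (i : ι) : n i = 1 := by
  have hprime (p : ℕ) : p.Prime → ∀ i, ¬ p ∣ n i := by
    induction p using Nat.strong_induction_on with
    | _ p ih =>
      intro hp i hpi
      obtain ⟨j, rfl⟩ := hσ i
      obtain ⟨q, hq, hqp, hqj⟩ :=
        exists_prime_lt_dvd_of_two_pow_modEq_one hp (hn j) ((h j).of_dvd hpi)
      exact ih q hqp hq j hqj
  by_contra hi
  exact hprime _ (Nat.minFac_prime hi) i (Nat.minFac_dvd _)

theorem finiteIndex_of_finite_stabilizer {A X : Type*} [Group A] [MulAction A X] {x : X}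
    [Finite (MulAction.stabilizer A x)] {H : Subgroup A} {W : Set X} (hW : W.Finite)
    (hH : ∀ a : A, ∃ b ∈ H, b • a • x ∈ W) : H.FiniteIndex := by
  have hfiber (w : X) : ((fun a : A => a • x) ⁻¹' {w}).Finite := by
    obtain hempty | ⟨a, rfl⟩ := Set.eq_empty_or_nonempty ((fun a : A => a • x) ⁻¹' {w})
    · exact hempty ▸ Set.finite_empty
    · refine ((Set.toFinite (MulAction.stabilizer A x : Set A)).image (a * ·)).subset ?_
      intro b hb
      exact ⟨a⁻¹ * b, by simpa [mul_smul, inv_smul_eq_iff] using hb, mul_inv_cancel_left a b⟩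
  have hS : ((fun a : A => a • x) ⁻¹' W).Finite := hW.preimage' fun w _ => hfiber w
  have : Finite ((fun a : A => a • x) ⁻¹' W) := hS
  have hsurj : Function.Surjective
      fun a : (fun a : A => a • x) ⁻¹' W => (QuotientGroup.mk (a : A)⁻¹ : A ⧸ H) := by
    intro q
    obtain ⟨a, rfl⟩ := QuotientGroup.mk_surjective q
    obtain ⟨b, hb, hW⟩ := hH a⁻¹
    exact ⟨⟨b * a⁻¹, by simpa [mul_smul] using hW⟩, QuotientGroup.eq.2 (by simpa using hb)⟩
  have := Finite.of_surjective _ hsurj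
  exact Subgroup.finiteIndex_of_finite_quotient

namespace Higman

theorem eq_top_of_normal_of_finiteIndex (N : Subgroup HigmanGroup) [N.Normal] [N.FiniteIndex] :
    N = ⊤ := by
  have hrel (i : Fin 4) : (gen i : HigmanGroup ⧸ N)⁻¹ * gen (i + 1) * gen i =
      (gen (i + 1) : HigmanGroup ⧸ N) ^ 2 :=
    congrArg (QuotientGroup.mk' N) (mul_inv_eq_one.1 (gen_rel i))
  have horder : ∀ i, orderOf (gen i : HigmanGroup ⧸ N) = 1 :=
    eq_one_of_two_pow_modEq_one (add_right_surjective 1) (fun i => (orderOf_pos _).ne')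
      fun i => pow_orderOf_modEq_one_of_conj_eq_pow (hrel i)
  rw [eq_top_iff, ← closure_range_gen, Subgroup.closure_le]
  rintro _ ⟨i, rfl⟩
  exact (QuotientGroup.eq_one_iff _).1 (orderOf_eq_one_iff.1 (horder i))

theorem eq_top_of_finiteIndex (K : Subgroup HigmanGroup) [K.FiniteIndex] : K = ⊤ :=
  top_le_iff.1 (eq_top_of_normal_of_finiteIndex K.normalCore ▸ K.normalCore_le)

/-! ### The stabiliser of the identity -/

theorem rotationHom_zero : rotationHom 0 = MonoidHom.id HigmanGroup :=
  PresentedGroup.ext fun i => (rotationHom_gen 0 i).trans (congrArg gen (add_zero i))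

theorem rotationHom_comp_rotationHom (k l : Fin 4) :
    (rotationHom l).comp (rotationHom k) = rotationHom (k + l) := by
  refine PresentedGroup.ext fun i => ?_
  change rotationHom l (rotationHom k (gen i)) = rotationHom (k + l) (gen i)
  rw [rotationHom_gen, rotationHom_gen, rotationHom_gen, add_assoc]

theorem rotation_pow_apply (n : ℕ) (g : HigmanGroup) :
    (rotation ^ n) g = rotationHom (n • 1) g := by
  induction n with
  | zero => rw [pow_zero, zero_nsmul, rotationHom_zero]; rfl
  | succ n ih =>
    rw [pow_succ', RelIso.mul_apply, ih, succ_nsmul, ← rotationHom_comp_rotationHom]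
    rfl

theorem stabilizer_one :
    MulAction.stabilizer (cayleyGraph ≃g cayleyGraph) (1 : HigmanGroup) =
      Subgroup.zpowers rotation := by
  refine le_antisymm (fun φ hφ => ?_) ?_
  · obtain ⟨k, hk⟩ := exists_apply_eq_mul_rotationHom φ
    have hsmul : ∀ k : Fin 4, (k : ℕ) • (1 : Fin 4) = k := by decide
    refine Subgroup.mem_zpowers_iff.2 ⟨(k : ℕ), RelIso.ext fun g => ?_⟩
    rw [zpow_natCast, rotation_pow_apply, hsmul, hk, show φ 1 = 1 from hφ, one_mul]
  · rw [Subgroup.zpowers_le]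
    exact map_one (rotationHom 1)

theorem rotation_pow_four : rotation ^ 4 = 1 := by
  ext g
  rw [rotation_pow_apply, show 4 • (1 : Fin 4) = 0 from rfl, rotationHom_zero]
  rfl

instance finite_stabilizer_one :
    Finite (MulAction.stabilizer (cayleyGraph ≃g cayleyGraph) (1 : HigmanGroup)) := by
  rw [stabilizer_one]
  exact finite_zpowers.2 (isOfFinOrder_iff_pow_eq_one.2 ⟨4, by norm_num, rotation_pow_four⟩)

end Higman

/-! ### Height functions -/

theorem IsGroupHeightFunction.map_mul {G : Type*} [Group G] {S : Set G} {h : G → ℤ}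
    (hh : IsGroupHeightFunction S h) (hS : Submonoid.closure S = ⊤) (x y : G) :
    h (x * y) = h x + h y := by
  have hlist (g : G) : ∃ l : List G, (∀ s ∈ l, s ∈ S) ∧ l.prod = g :=
    Submonoid.exists_list_of_mem_closure (hS ▸ Submonoid.mem_top g)
  obtain ⟨l, hl, rfl⟩ := hlist x
  obtain ⟨m, hm, rfl⟩ := hlist y
  rw [← List.prod_append, hh.map_prod _ hl, hh.map_prod _ hm, ← List.sum_append, ← List.map_append]
  exact hh.map_prod _ fun s hs => (List.mem_append.1 hs).elim (hl s) (hm s)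

/-- The action of a group on its Cayley graph by left translations. -/
def leftTranslation {G : Type*} [Group G] (S : Set G) :
    G →* (SimpleGraph.mulCayley S ≃g SimpleGraph.mulCayley S) where
  toFun g := ⟨Equiv.mulLeft g, SimpleGraph.mulCayley_adj_mul_iff_right⟩
  map_one' := RelIso.ext one_mul
  map_mul' g g' := RelIso.ext (mul_assoc g g')

namespace Higman

theorem monoidHom_eq_one {A : Type*} [CommGroup A] (f : HigmanGroup →* A) : f = 1 := by
  refine PresentedGroup.ext fun i => ?_
  have h := congrArg f (mul_inv_eq_one.1 (gen_rel (i - 1)))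
  rw [sub_add_cancel, pow_two, map_mul, map_mul, map_mul, map_inv, mul_right_comm, inv_mul_cancel,
    one_mul, left_eq_mul] at h
  exact h

theorem eq_zero_of_map_mul {A : Type*} [AddCommGroup A] {h : HigmanGroup → A}
    (hh : ∀ x y, h (x * y) = h x + h y) (g : HigmanGroup) : h g = 0 :=
  congrArg Multiplicative.toAdd <| DFunLike.congr_fun
    (monoidHom_eq_one (MonoidHom.mk' (fun x => Multiplicative.ofAdd (h x)) hh)) g

theorem submonoidClosure_generators : Submonoid.closure generators = ⊤ := by
  refine (Submonoid.eq_top_iff' _).2 fun g => ?_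
  obtain ⟨l, rfl⟩ := exists_wordValue_eq closure_range_gen g
  refine Submonoid.list_prod_mem _ fun t ht => Submonoid.subset_closure ?_
  obtain ⟨s, -, hs⟩ := List.mem_map.1 ht
  exact mem_generators_iff.2 ⟨s, hs⟩

theorem not_isGroupHeightFunction (h : HigmanGroup → ℤ) :
    ¬ IsGroupHeightFunction generators h := by
  intro hh
  obtain ⟨g, hg⟩ := hh.ne_zero
  exact hg (eq_zero_of_map_mul (hh.map_mul submonoidClosure_generators) g)

theorem leftTranslation_mem_of_actsQuasiTransitively
    {H : Subgroup (cayleyGraph ≃g cayleyGraph)} (hH : ActsQuasiTransitively cayleyGraph H)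
    (g : HigmanGroup) : leftTranslation generators g ∈ H := by
  obtain ⟨W, hW, hmeet⟩ := hH
  have : H.FiniteIndex := finiteIndex_of_finite_stabilizer (x := (1 : HigmanGroup)) hW fun α => by
    obtain ⟨β, hβ, w, hw, h⟩ := hmeet (α 1)
    exact ⟨β, hβ, show β (α 1) ∈ W from h.symm ▸ hw⟩
  have hcomap : (H.comap (leftTranslation generators)).FiniteIndex :=
    ⟨(Subgroup.index_comap H _).trans_ne Subgroup.FiniteIndex.index_ne_zero⟩
  have htop : H.comap (leftTranslation generators) = ⊤ := eq_top_of_finiteIndex _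
  exact (Subgroup.eq_top_iff' _).1 htop g

theorem not_isGraphHeightFunction (h : HigmanGroup → ℤ)
    (H : Subgroup (cayleyGraph ≃g cayleyGraph)) : ¬ IsGraphHeightFunction cayleyGraph 1 h H := by
  intro hh
  have hadd (x y : HigmanGroup) : h (x * y) = h x + h y := by
    have hdiff : h y - h 1 = h (x * y) - h (x * 1) := hh.differenceInvariant y 1 _
      (leftTranslation_mem_of_actsQuasiTransitively hh.quasiTransitive x)
    rw [hh.map_origin, mul_one] at hdiff
    linarith
  obtain ⟨u, -, -, -, hlt, -⟩ := hh.exists_lt_lt 1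
  rw [eq_zero_of_map_mul hadd u, hh.map_origin] at hlt
  exact lt_irrefl 0 hlt

end Higman

/-- The Cayley graph of the Higman group has no graph height function. Moreover the group has no
group height function, the stabiliser of the identity vertex in the automorphism group of the
Cayley graph is the cyclic group generated by the rotation of the generators, and the group has
no proper normal subgroup of finite index. -/
theorem mainTheorem5 :
    (¬ ∃ (h : Higman.HigmanGroup → ℤ) (H : Subgroup (Higman.cayleyGraph ≃g Higman.cayleyGraph)),
      IsGraphHeightFunction Higman.cayleyGraph 1 h H) ∧
    (¬ ∃ h : Higman.HigmanGroup → ℤ, IsGroupHeightFunction Higman.generators h) ∧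
    MulAction.stabilizer (Higman.cayleyGraph ≃g Higman.cayleyGraph) (1 : Higman.HigmanGroup) =
      Subgroup.zpowers Higman.rotation ∧
    (∀ N : Subgroup Higman.HigmanGroup, N.Normal → N.FiniteIndex → N = ⊤) :=
  ⟨fun ⟨h, H, hh⟩ => Higman.not_isGraphHeightFunction h H hh,
    fun ⟨h, hh⟩ => Higman.not_isGroupHeightFunction h hh,
    Higman.stabilizer_one,
    fun N _ _ => Higman.eq_top_of_normal_of_finiteIndex N⟩
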